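/- A multiplicative lattice is a commutative monoid $\mathcal{L}$ with a partial order making it a complete lattice, such that the multiplicative identity $1$ is the top element and $x\bigvee_{y\in S}y=\bigvee_{y\in S}xy$ for all $x\in\mathcal{L}$, $S\subseteq\mathcal{L}$; its bottom element is $0$. We assume $\mathcal{L}$ has more than one element. It is a multiplicative lattice domain if $ab=0$ implies $a=0$ or $b=0$. An element $x$ is compact if $x\le\bigvee S$ implies $x\le\bigvee F$ for some finite $F\subseteq S$. $\mathcal{L}$ is a $C$-lattice if $1$ is compact, products of two compact elements are compact, and every element is a join of compact elements. For $x,y\in\mathcal{L}$ let $(y:x)=\bigvee\{a\in\mathcal{L}\mid ax\le y\}$ and $\sqrt{x}=\bigvee\{y\in\mathcal{L}\mid y^n\le x\text{ for some integer }n\ge 1\}$. An element $x$ is - $\ell$-radical if $x=\sqrt{x}$; - $\ell$-prime if $x\ne 1$ and, for all $a,b\in\mathcal{L}$, $ab\le x$ implies $a\le x$ or $b\le x$; - maximal if it is maximal among the elements different from $1$; - $\ell$-principal if $y\wedge zx=((y:x)\wedge z)x$ and $y\vee(z:x)=((yx\vee z):x)$ for all $y,z\in\mathcal{L}$; - $\ell$-invertible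 if it is $\ell$-principal and cancellative (i.e. $xy=xz$ implies $y=z$ for all $y,z\in\mathcal{L}$). $\mathcal{L}$ is principally generated if every element is a join of $\ell$-principal elements. The dimension $\dim\mathcal{L}$ is the supremum of the integers $k$ for which there is a chain $p_0<p_1<\dots<p_k$ of $\ell$-prime elements. Products below are finite products of at least one factor. Theorem 4.6. Let $\mathcal{L}$ be a principally generated $C$-lattice that is a multiplicative lattice domain. The following are equivalent. 1. $\mathcal{L}$ is a radical factorial lattice, i.e. every element of $\mathcal{L}$ is a product of $\ell$-radical elements. 2. $\dim\mathcal{L}\le 1$ and every $\ell$-invertible element is a product of $\ell$-radical elements. 3. Every nonzero $\ell$-prime element $p$ is maximal and there is an $\ell$-invertible $\ell$-radical element $y$ with $y\le p$. 4. Every element of $\mathcal{L}$ is a product $x_1\cdots x_n$ of $\ell$-radical elements with $x_1\le\dots\le x_n$. 5. For every nonzero compact element $x$, the element $\sqrt{x}$ is $\ell$-invertible. 6. Every nonzero compact element is $\ell$-invertible, and $\sqrt{x}$ is compact for every compact element $x$. -/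

import Mathlib

/-- A multiplicative lattice: a commutative monoid on a complete lattice whose multiplication
distributes over arbitrary joins (`IsQuantale`) and whose identity is the top element. -/
class IsMultiplicativeLattice (L : Type*) [CommMonoid L] [CompleteLattice L] : Prop
    extends IsQuantale L where
  one_eq_top : (1 : L) = ⊤

namespace MultLattice

section

variable {L : Type*} [CommMonoid L] [CompleteLattice L]

/-- The residual `(y : x) = ⋁ {a | a * x ≤ y}`. -/
def residual (y x : L) : L := sSup {a | a * x ≤ y}

/-- `√x = ⋁ {y | y ^ n ≤ x for some positive integer n}`. -/
def radical (x : L) : L := sSup {y | ∃ n : ℕ, 1 ≤ n ∧ y ^ n ≤ x}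

/-- `x` is `ℓ`-radical. -/
def IsLRadical (x : L) : Prop := radical x = x

/-- `p` is `ℓ`-prime. -/
def IsLPrime (p : L) : Prop := p ≠ 1 ∧ ∀ a b : L, a * b ≤ p → a ≤ p ∨ b ≤ p

/-- `x` is a maximal element, that is, maximal among the elements different from `1`
(the top element). -/
def IsMaximalElement (x : L) : Prop := Maximal (fun y : L => y ≠ 1) x

/-- `x` is a cancellative element of the monoid. -/
def IsCancellative (x : L) : Prop := ∀ y z : L, x * y = x * z → y = z

/-- `x` is meet principal. -/
def IsMeetPrincipal (x : L) : Prop :=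
  ∀ y z : L, y ⊓ z * x = (residual y x ⊓ z) * x

/-- `x` is join principal. -/
def IsJoinPrincipal (x : L) : Prop :=
  ∀ y z : L, y ⊔ residual z x = residual (y * x ⊔ z) x

/-- `x` is `ℓ`-principal. -/
def IsLPrincipal (x : L) : Prop := IsMeetPrincipal x ∧ IsJoinPrincipal x

/-- `x` is `ℓ`-invertible. -/
def IsLInvertible (x : L) : Prop := IsLPrincipal x ∧ IsCancellative x

/-- `x` is a (nonempty, finite) product of `ℓ`-radical elements. -/
def IsProductOfLRadicals (x : L) : Prop :=
  ∃ (n : ℕ) (f : Fin n → L), 1 ≤ n ∧ (∀ i, IsLRadical (f i)) ∧ x = ∏ i, f i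

/-- `x` is a product `x₁ ⋯ xₙ` of `ℓ`-radical elements with `n ≥ 1` and `x₁ ≤ ⋯ ≤ xₙ`. -/
def IsProductOfLRadicalChain (x : L) : Prop :=
  ∃ (n : ℕ) (f : Fin n → L), 1 ≤ n ∧ Monotone f ∧ (∀ i, IsLRadical (f i)) ∧ x = ∏ i, f i

end

section

variable (L : Type*) [CommMonoid L] [CompleteLattice L]

/-- Zero-divisor freeness. The zero of a multiplicative lattice is its bottom element. -/
def IsLatticeDomain : Prop := ∀ a b : L, a * b = ⊥ → a = ⊥ ∨ b = ⊥

/-- The `C`-lattice condition: the compact elements form a submonoid, and every element is a join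
of compact elements. -/
def IsCLattice : Prop :=
  IsCompactElement (1 : L) ∧
  (∀ x y : L, IsCompactElement x → IsCompactElement y → IsCompactElement (x * y)) ∧
  ∀ x : L, ∃ S : Set L, (∀ s ∈ S, IsCompactElement s) ∧ x = sSup S

/-- Every element is a join of `ℓ`-principal elements. -/
def IsPrincipallyGenerated : Prop :=
  ∀ x : L, ∃ S : Set L, (∀ s ∈ S, IsLPrincipal s) ∧ x = sSup S

/-- Every element is a product of `ℓ`-radical elements. -/
def IsRadicalFactorial : Prop := ∀ x : L, IsProductOfLRadicals x

/-- The dimension: the supremum of the numbers `k` such that there is a chain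
`p₀ < p₁ < ⋯ < p_k` of `ℓ`-prime elements. -/
noncomputable def dim : WithBot ℕ∞ := Order.krullDim {p : L // IsLPrime p}

end

end MultLattice

/-! The model is ideal theory in a domain: invertible elements act as invertible ideals, and `LocLE
m` compares elements in the localization at `m` without constructing it. The cycle is 1 → 2 → 3 → 5
→ 4 → 1, together with 5 ↔ 6.

For dimension at most one, suppose a prime lies strictly between `⊥` and a prime `m`, which may be
taken minimal over `p ∨ s`. Factoring `p ∨ s²` shows that `m` is not locally idempotent; factoring
`e ∨ z²` then shows that `m` is locally generated by one principal element `e`; finally an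
invertible radical element below `p` contradicts this (`IsRadicalFactorial.le_of_locLE`).

For 3 → 5, an invertible radical element below `p` is a local uniformizer, so nonzero compact
elements behave locally as in a discrete valuation ring. Local comparability gives `(a ∨ b)(a ∧ b) =
ab`, hence compact elements are invertible as in a Prüfer domain. Compactness of `1` glues local
uniformizers into a single `y` with `√x = x ∨ y`.

From 5, write `x = √x · (x : √x)`. Passing to the cofactor lowers the exponent `n` in `√x ^ n ≤ x`,
so compact elements are products of invertible radicals. The cofactor is monotone on nonzero compact
elements, so the factorization extends to joins and gives chains. -/

namespace MultLattice

/-- A principally generated `C`-lattice that is a multiplicative lattice domain. -/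
class IsPrincipalCLatticeDomain (L : Type*) [CommMonoid L] [CompleteLattice L] : Prop
    extends IsMultiplicativeLattice L, Nontrivial L where
  domain : IsLatticeDomain L
  cLattice : IsCLattice L
  principallyGenerated : IsPrincipallyGenerated L

theorem IsLPrime.not_mul_le {L : Type*} [CommMonoid L] [CompleteLattice L] {p a b : L}
    (hp : IsLPrime p) (ha : ¬ a ≤ p) (hb : ¬ b ≤ p) : ¬ a * b ≤ p :=
  fun h => (hp.2 _ _ h).elim ha hb

theorem IsCompactElement.sup {L : Type*} [CompleteLattice L] {a b : L}
    (ha : IsCompactElement a) (hb : IsCompactElement b) : IsCompactElement (a ⊔ b) := by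
  classical
  have := CompleteLattice.isCompactElement_finsetSup (f := id) {a, b} (by simp [ha, hb])
  simpa using this

/-! ### Residuals, radicals, primes and local comparison. -/

section Basic

variable {L : Type*} [CommMonoid L] [CompleteLattice L] [IsMultiplicativeLattice L]

theorem le_one_of_top (a : L) : a ≤ 1 := by
  rw [IsMultiplicativeLattice.one_eq_top]; exact le_top

theorem mul_le_left_self (a b : L) : a * b ≤ a := by
  simpa using mul_le_mul_right (le_one_of_top b) a

theorem mul_le_right_self (a b : L) : a * b ≤ b := by
  rw [mul_comm]; exact mul_le_left_self b a

theorem mul_bot_eq (a : L) : a * ⊥ = ⊥ := le_bot_iff.1 (mul_le_right_self a ⊥)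

theorem mul_sup_eq (a b c : L) : a * (b ⊔ c) = a * b ⊔ a * c := Quantale.mul_sup_distrib

theorem sup_mul_eq (a b c : L) : (a ⊔ b) * c = a * c ⊔ b * c := Quantale.sup_mul_distrib

theorem le_residual {a x y : L} : a ≤ residual y x ↔ a * x ≤ y :=
  Quantale.leftMulResiduation_le_iff_mul_le (x := a) (y := x) (z := y)

theorem residual_mul_le (x y : L) : residual y x * x ≤ y := le_residual.1 le_rfl

theorem self_le_residual (x y : L) : y ≤ residual y x := le_residual.2 (mul_le_left_self y x)

theorem eq_of_mul_le_of_sup_eq_one {a w z : L} (h : w ⊔ z = 1) (haw : a * w ≤ z) : a ≤ z := by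
  calc a = a * w ⊔ a * z := by rw [← mul_sup_eq, h, mul_one]
    _ ≤ z := sup_le haw (mul_le_right_self a z)

theorem sup_pow_add_le (a b : L) (n m : ℕ) : (a ⊔ b) ^ (n + m) ≤ a ^ n ⊔ b ^ m := by
  induction n generalizing m with
  | zero => exact le_sup_of_le_left (by simpa using le_one_of_top _)
  | succ n ihn =>
    induction m with
    | zero => exact le_sup_of_le_right (by simpa using le_one_of_top _)
    | succ m ihm =>
      have e : (a ⊔ b) ^ (n + 1 + (m + 1))
          = a * (a ⊔ b) ^ (n + (m + 1)) ⊔ b * (a ⊔ b) ^ (n + 1 + m) := by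
        rw [show n + (m + 1) = n + 1 + m by omega, ← sup_mul_eq, ← pow_succ', ← add_assoc]
      rw [e]
      refine sup_le ((mul_le_mul_right (ihn (m + 1)) a).trans ?_)
        ((mul_le_mul_right ihm b).trans ?_)
      · rw [mul_sup_eq, ← pow_succ']
        exact sup_le_sup_left (mul_le_right_self _ _) _
      · rw [mul_sup_eq, ← pow_succ']
        exact sup_le_sup_right (mul_le_right_self _ _) _

theorem pow_sup_pow_eq_one {a b : L} (h : a ⊔ b = 1) (n m : ℕ) : a ^ n ⊔ b ^ m = 1 := by
  refine le_antisymm (le_one_of_top _) ?_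
  simpa [h] using sup_pow_add_le a b n m

theorem le_radical_of_pow_le {x y : L} {n : ℕ} (h : y ^ n ≤ x) : y ≤ radical x := by
  -- The definition asks for a positive exponent; raising it by one lets `n = 0` be allowed here.
  refine le_sSup ⟨n + 1, by omega, ?_⟩
  rw [pow_succ]
  exact (mul_le_left_self _ _).trans h

theorem le_radical (x : L) : x ≤ radical x := le_radical_of_pow_le (n := 1) (by simp)

theorem radical_mono {x y : L} (h : x ≤ y) : radical x ≤ radical y :=
  sSup_le fun _ ⟨_, _, ha⟩ => le_radical_of_pow_le (ha.trans h)

theorem IsLRadical.le_of_pow_le {x y : L} (hx : IsLRadical x) {n : ℕ} (h : y ^ n ≤ x) : y ≤ x :=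
  (le_radical_of_pow_le h).trans hx.le

theorem IsLRadical.of_forall {x : L} (h : ∀ (y : L) (n : ℕ), y ^ n ≤ x → y ≤ x) : IsLRadical x :=
  le_antisymm (sSup_le fun y ⟨n, _, hy⟩ => h y n hy) (le_radical x)

theorem IsLRadical.inf {x y : L} (hx : IsLRadical x) (hy : IsLRadical y) : IsLRadical (x ⊓ y) :=
  .of_forall fun _ _ h => le_inf (hx.le_of_pow_le (h.trans inf_le_left))
    (hy.le_of_pow_le (h.trans inf_le_right))

theorem isLRadical_one : IsLRadical (1 : L) := .of_forall fun y _ _ => le_one_of_top y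

theorem exists_pow_le_of_le_radical {c x : L} (hc : IsCompactElement c) (h : c ≤ radical x) :
    ∃ n : ℕ, c ^ n ≤ x := by
  have hdir : DirectedOn (· ≤ ·) {y | ∃ n : ℕ, 1 ≤ n ∧ y ^ n ≤ x} := by
    rintro a ⟨n, hn, ha⟩ b ⟨m, hm, hb⟩
    exact ⟨a ⊔ b, ⟨n + m, by omega, (sup_pow_add_le a b n m).trans (sup_le ha hb)⟩,
      le_sup_left, le_sup_right⟩
  obtain ⟨y, ⟨n, -, hy⟩, hcy⟩ := hc {y | ∃ n : ℕ, 1 ≤ n ∧ y ^ n ≤ x} (radical x)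
    ⟨x, 1, le_rfl, by simp⟩ hdir (isLUB_sSup _) h
  exact ⟨n, (pow_le_pow_left' hcy n).trans hy⟩

theorem IsLPrime.one_not_le {p : L} (hp : IsLPrime p) : ¬ 1 ≤ p :=
  fun h => hp.1 (le_antisymm (le_one_of_top _) h)

theorem IsLPrime.le_of_pow_le {p x : L} (hp : IsLPrime p) {n : ℕ} (h : x ^ n ≤ p) : x ≤ p := by
  induction n with
  | zero => exact absurd (by simpa using h) hp.one_not_le
  | succ n ih => exact (hp.2 _ _ (by rwa [← pow_succ])).elim ih id

theorem IsLPrime.isLRadical {p : L} (hp : IsLPrime p) : IsLRadical p :=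
  .of_forall fun _ _ => hp.le_of_pow_le

theorem IsLPrime.exists_le_of_prod_le {ι : Type*} {p : L} (hp : IsLPrime p) (s : Finset ι)
    (f : ι → L) (h : ∏ i ∈ s, f i ≤ p) : ∃ i ∈ s, f i ≤ p := by
  by_contra! H
  exact Finset.prod_induction f (fun x => ¬ x ≤ p) (fun _ _ => hp.not_mul_le) hp.one_not_le H h

/-- The element of a factorization lying below a prime, and the complementary factor. -/
theorem IsProductOfLRadicals.exists_factor {p x : L} (hp : IsLPrime p)
    (hx : IsProductOfLRadicals x) (hxp : x ≤ p) :
    ∃ b c : L, IsLRadical b ∧ b ≤ p ∧ x = b * c := by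
  obtain ⟨n, f, -, hf, rfl⟩ := hx
  obtain ⟨i, hi, hip⟩ := hp.exists_le_of_prod_le _ f hxp
  exact ⟨f i, _, hf i, hip, (Finset.mul_prod_erase _ f hi).symm⟩

/-- `a ≤ b` in the localization at `m`. -/
def LocLE (m a b : L) : Prop := ∃ t : L, ¬ t ≤ m ∧ t * a ≤ b

theorem LocLE.of_le {m a b : L} (hm : IsLPrime m) (h : a ≤ b) : LocLE m a b :=
  ⟨1, hm.one_not_le, by simpa using h⟩

theorem LocLE.trans {m a b c : L} (hm : IsLPrime m) : LocLE m a b → LocLE m b c → LocLE m a c := by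
  rintro ⟨t, ht, hab⟩ ⟨s, hs, hbc⟩
  refine ⟨s * t, hm.not_mul_le hs ht, ?_⟩
  rw [mul_assoc]
  exact (mul_le_mul_right hab s).trans hbc

theorem LocLE.mul {m a b c d : L} (hm : IsLPrime m) :
    LocLE m a b → LocLE m c d → LocLE m (a * c) (b * d) := by
  rintro ⟨t, ht, hab⟩ ⟨s, hs, hcd⟩
  refine ⟨t * s, hm.not_mul_le ht hs, ?_⟩
  rw [mul_mul_mul_comm]
  exact mul_le_mul' hab hcd

theorem LocLE.sup {m a b c : L} (hm : IsLPrime m) :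
    LocLE m a c → LocLE m b c → LocLE m (a ⊔ b) c := by
  rintro ⟨t, ht, hab⟩ ⟨s, hs, hcd⟩
  refine ⟨t * s, hm.not_mul_le ht hs, ?_⟩
  rw [mul_sup_eq]
  refine sup_le ?_ ?_
  · rw [mul_right_comm]; exact (mul_le_left_self _ _).trans hab
  · rw [mul_assoc]; exact (mul_le_right_self _ _).trans hcd

theorem LocLE.finset_sup {ι : Type*} {m c : L} (hm : IsLPrime m) (s : Finset ι) (f : ι → L)
    (h : ∀ i ∈ s, LocLE m (f i) c) : LocLE m (s.sup f) c :=
  Finset.sup_induction (p := fun x => LocLE m x c) (.of_le hm bot_le)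
    (fun _ ha _ hb => .sup hm ha hb) h

/-- Local comparison can be tested on the elements of a set whose join dominates a compact
element. -/
theorem LocLE.of_le_sSup {m c b : L} (hm : IsLPrime m) (hc : IsCompactElement c) {S : Set L}
    (hcS : c ≤ sSup S) (h : ∀ s ∈ S, LocLE m s b) : LocLE m c b := by
  obtain ⟨t, ht, hct⟩ :=
    (CompleteLattice.isCompactElement_iff_exists_le_sSup_of_le_sSup _ c).1 hc S hcS
  exact (LocLE.of_le hm hct).trans hm (.finset_sup hm t id fun i hi => h i (ht hi))

end Basic

/-! ### Principal and invertible elements. -/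

section Principal

variable {L : Type*} [CommMonoid L] [CompleteLattice L] [IsMultiplicativeLattice L]

theorem IsLPrincipal.residual_mul {x y : L} (hx : IsLPrincipal x) (h : y ≤ x) :
    residual y x * x = y := by
  have := hx.1 y 1
  rw [one_mul, inf_eq_left.2 h, inf_eq_left.2 (le_one_of_top _)] at this
  exact this.symm

theorem IsLPrincipal.exists_eq_mul {x y : L} (hx : IsLPrincipal x) (h : y ≤ x) :
    ∃ z, y = x * z := ⟨residual y x, by rw [mul_comm, hx.residual_mul h]⟩

theorem IsLPrincipal.le_sup_residual {t x y z : L} (hx : IsLPrincipal x)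
    (h : t * x ≤ y * x ⊔ z) : t ≤ y ⊔ residual z x := by
  rw [hx.2 y z]; exact le_residual.2 h

theorem IsCancellative.le_of_mul_le_mul {x a b : L} (hx : IsCancellative x) (h : x * a ≤ x * b) :
    a ≤ b := by
  have : x * (a ⊔ b) = x * b := by rw [mul_sup_eq, sup_eq_right.2 h]
  exact sup_eq_right.1 (hx _ _ this)

theorem isLInvertible_one : IsLInvertible (1 : L) := by
  have h (z : L) : residual z 1 = z :=
    le_antisymm (by simpa using residual_mul_le 1 z) (self_le_residual 1 z)
  exact ⟨⟨fun y z => by simp [h], fun y z => by simp [h]⟩, fun y z h => by simpa using h⟩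

theorem residual_residual (x a b : L) : residual (residual x b) a = residual x (a * b) :=
  eq_of_forall_le_iff fun c => by rw [le_residual, le_residual, le_residual, mul_assoc]

theorem IsLPrincipal.mul {a b : L} (ha : IsLPrincipal a) (hb : IsLPrincipal b) :
    IsLPrincipal (a * b) := by
  refine ⟨fun y z => ?_, fun y z => ?_⟩
  · rw [← mul_assoc, hb.1, ha.1, residual_residual, mul_assoc]
  · rw [← residual_residual, ha.2, hb.2, residual_residual, mul_assoc]

theorem IsLInvertible.mul {a b : L} (ha : IsLInvertible a) (hb : IsLInvertible b) :
    IsLInvertible (a * b) :=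
  ⟨ha.1.mul hb.1, fun y z h => hb.2 _ _ (ha.2 _ _ (by simpa only [mul_assoc] using h))⟩

theorem IsLInvertible.pow {a : L} (ha : IsLInvertible a) (n : ℕ) : IsLInvertible (a ^ n) := by
  induction n with
  | zero => simpa using isLInvertible_one
  | succ n ih => rw [pow_succ]; exact ih.mul ha

/-- Cancelling `b` gives `(yb : ab) = (y : a)`, so both principal identities for `a` are those of
`ab` with `b` removed. -/
theorem IsLInvertible.of_mul_left {a b : L} (h : IsLInvertible (a * b)) : IsLInvertible a := by
  have hb : IsCancellative b := fun y z e => h.2 _ _ (by rw [mul_assoc, mul_assoc, e])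
  have ha : IsCancellative a := fun y z e => h.2 _ _ (by
    rw [mul_right_comm, e, mul_right_comm])
  have key (y : L) : residual (y * b) (a * b) = residual y a := eq_of_forall_le_iff fun c => by
    rw [le_residual, le_residual, ← mul_assoc]
    refine ⟨fun h => ?_, fun h => mul_le_mul_left h b⟩
    exact IsCancellative.le_of_mul_le_mul hb (by rwa [mul_comm b, mul_comm b])
  refine ⟨⟨fun y z => le_antisymm ?_ ?_, fun y z => ?_⟩, ha⟩
  · refine IsCancellative.le_of_mul_le_mul hb ?_
    calc b * (y ⊓ z * a) ≤ (y * b) ⊓ (z * (a * b)) := by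
          rw [← mul_assoc, mul_comm b]
          exact le_inf (mul_le_mul_left inf_le_left b) (mul_le_mul_left inf_le_right b)
      _ = b * ((residual y a ⊓ z) * a) := by rw [h.1.1, key, ← mul_assoc, mul_comm b]
  · exact le_inf ((mul_le_mul_left inf_le_left a).trans (residual_mul_le _ _))
      (mul_le_mul_left inf_le_right a)
  · rw [← key z, h.1.2, ← mul_assoc, ← sup_mul_eq, key]

theorem IsLInvertible.of_mul_right {a b : L} (h : IsLInvertible (a * b)) : IsLInvertible b :=
  IsLInvertible.of_mul_left (b := a) (by rwa [mul_comm])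

theorem isCompactElement_of_mul {x a : L} (hx : IsCancellative x)
    (h : IsCompactElement (x * a)) : IsCompactElement a := by
  rw [CompleteLattice.isCompactElement_iff_exists_le_sSup_of_le_sSup] at h ⊢
  classical
  intro S hS
  obtain ⟨t, ht, hat⟩ := h ((x * ·) '' S) (by
    rw [sSup_image, ← mul_sSup_distrib]; exact mul_le_mul_right hS x)
  obtain ⟨u, hu, rfl⟩ := Finset.subset_set_image_iff.1 ht
  refine ⟨u, hu, IsCancellative.le_of_mul_le_mul hx (hat.trans (Finset.sup_le fun i hi => ?_))⟩
  obtain ⟨j, hj, rfl⟩ := Finset.mem_image.1 hi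
  exact mul_le_mul_right (Finset.le_sup (f := id) hj) x

end Principal

/-! ### Compactness, maximal elements and minimal primes. -/

section Domain

variable {L : Type*} [CommMonoid L] [CompleteLattice L] [IsPrincipalCLatticeDomain L]

open IsPrincipalCLatticeDomain

theorem isCompactElement_one : IsCompactElement (1 : L) := cLattice.1

theorem IsCompactElement.mul {a b : L} (ha : IsCompactElement a) (hb : IsCompactElement b) :
    IsCompactElement (a * b) := cLattice.2.1 a b ha hb

theorem IsCompactElement.pow {a : L} (ha : IsCompactElement a) (n : ℕ) :
    IsCompactElement (a ^ n) := by
  induction n with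
  | zero => simpa using isCompactElement_one
  | succ n ih => rw [pow_succ]; exact IsCompactElement.mul ih ha

instance : IsCompactlyGenerated L :=
  ⟨fun x => (cLattice.2.2 x).imp fun _ h => ⟨h.1, h.2.symm⟩⟩

theorem le_of_forall_compact {a b : L} (h : ∀ c, IsCompactElement c → c ≤ a → c ≤ b) : a ≤ b :=
  le_iff_compact_le_imp.2 h

theorem exists_compact_not_le {a b : L} (h : ¬ a ≤ b) :
    ∃ c, IsCompactElement c ∧ c ≤ a ∧ ¬ c ≤ b := by
  contrapose! h
  exact le_of_forall_compact h

theorem exists_principal_not_le {a b : L} (h : ¬ a ≤ b) :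
    ∃ c, IsLPrincipal c ∧ c ≤ a ∧ ¬ c ≤ b := by
  obtain ⟨S, hS, rfl⟩ := principallyGenerated a
  contrapose! h
  exact sSup_le fun s hs => h s (hS s hs) (le_sSup hs)

theorem bot_ne_one : (⊥ : L) ≠ 1 := by
  rw [IsMultiplicativeLattice.one_eq_top]; exact bot_ne_top

theorem isLPrime_bot : IsLPrime (⊥ : L) :=
  ⟨bot_ne_one, fun a b h => by simpa using domain a b (le_bot_iff.1 h)⟩

theorem IsLInvertible.ne_bot {x : L} (hx : IsLInvertible x) : x ≠ ⊥ := by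
  rintro rfl
  exact bot_ne_one (hx.2 ⊥ 1 (by rw [mul_comm, mul_bot_eq, mul_one]))

/-- In a domain `(⊥ : x) = ⊥`, so join principality at `z = ⊥` reads `(xy : x) = y`, and this
recovers `y` from `xy`. -/
theorem IsLPrincipal.isLInvertible {x : L} (hx : IsLPrincipal x) (h0 : x ≠ ⊥) :
    IsLInvertible x := by
  have h (y : L) : residual (x * y) x = y := by
    have h1 := hx.2 y ⊥
    have h2 : residual ⊥ x = ⊥ := le_bot_iff.1
      ((isLPrime_bot.2 _ _ (residual_mul_le x ⊥)).resolve_right fun h => h0 (le_bot_iff.1 h))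
    rw [h2, sup_bot_eq, sup_bot_eq] at h1
    rw [mul_comm, ← h1]
  exact ⟨hx, fun y z e => by rw [← h y, e, h z]⟩

/-- Meet principality turns `x ≤ ⋁ S` into `x = (⋁ (s : x)) x`, and join principality cancels `x`.
Compactness of `1` then gives a single `s` with `(s : x) = 1`. -/
theorem IsLPrincipal.isCompactElement {x : L} (hx : IsLPrincipal x) : IsCompactElement x := by
  intro S u hne hdir hu hxu
  obtain rfl := hu.sSup_eq
  have h1 : x = (⨆ s ∈ S, residual s x) * x := by
    refine le_antisymm ?_ (mul_le_right_self _ _)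
    conv_lhs => rw [← inf_eq_left.2 hxu, hdir.inf_sSup_eq]
    refine iSup₂_le fun s hs => ?_
    have := hx.1 s 1
    rw [one_mul, inf_eq_left.2 (le_one_of_top (residual s x)), inf_comm] at this
    rw [this]
    exact mul_le_mul_left (le_iSup₂ (f := fun s (_ : s ∈ S) => residual s x) s hs) x
  have h2 : (1 : L) ≤ ⨆ s ∈ S, residual s x := by
    have := hx.le_sup_residual (t := 1) (y := ⨆ s ∈ S, residual s x) (z := ⊥)
      (by rw [← h1]; simp)
    refine this.trans (sup_le le_rfl ?_)
    obtain ⟨s, hs⟩ := hne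
    exact le_iSup₂_of_le s hs (le_residual.2 ((residual_mul_le _ _).trans bot_le))
  have hmono : ∀ {s t : L}, s ≤ t → residual s x ≤ residual t x := fun h =>
    le_residual.2 ((residual_mul_le _ _).trans h)
  obtain ⟨_, ⟨s, hs, rfl⟩, h3⟩ := isCompactElement_one ((fun s => residual s x) '' S)
    (⨆ s ∈ S, residual s x) (hne.image _)
    (by
      rintro _ ⟨a, ha, rfl⟩ _ ⟨b, hb, rfl⟩
      obtain ⟨d, hd, had, hbd⟩ := hdir a ha b hb
      exact ⟨_, ⟨d, hd, rfl⟩, hmono had, hmono hbd⟩)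
    (by rw [← sSup_image]; exact isLUB_sSup _) h2
  exact ⟨s, hs, by simpa using le_residual.1 h3⟩

theorem IsLInvertible.isCompactElement {x : L} (hx : IsLInvertible x) : IsCompactElement x :=
  IsLPrincipal.isCompactElement hx.1

theorem exists_isLInvertible_le {x : L} (hx : x ≠ ⊥) : ∃ a, IsLInvertible a ∧ a ≤ x := by
  obtain ⟨c, hc, hcx, h⟩ := exists_principal_not_le (fun h => hx (le_bot_iff.1 h))
  exact ⟨c, hc.isLInvertible (fun h' => h h'.le), hcx⟩

theorem isLRadical_radical (x : L) : IsLRadical (radical x) := by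
  refine .of_forall fun y n h => le_of_forall_compact fun c hc hcy => ?_
  obtain ⟨m, hm⟩ := exists_pow_le_of_le_radical (IsCompactElement.pow hc n)
    ((pow_le_pow_left' hcy n).trans h)
  exact le_radical_of_pow_le (n := n * m) (by rwa [pow_mul])

theorem isLRadical_bot : IsLRadical (⊥ : L) := isLPrime_bot.isLRadical

theorem IsMaximalElement.isLPrime {m : L} (hm : IsMaximalElement m) : IsLPrime m := by
  refine ⟨hm.1, fun a b h => ?_⟩
  by_contra! H
  have key : ∀ c : L, ¬ c ≤ m → c ⊔ m = 1 := fun c hc => by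
    by_contra h1
    exact hc (le_sup_left.trans (hm.2 h1 le_sup_right))
  exact H.1 (eq_of_mul_le_of_sup_eq_one (key b H.2) h)

theorem exists_isMaximalElement_ge {x : L} (hx : x ≠ 1) : ∃ m, IsMaximalElement m ∧ x ≤ m := by
  have hco := CompleteLattice.coatomic_of_top_compact (α := L) (by
    rw [← IsMultiplicativeLattice.one_eq_top]; exact isCompactElement_one)
  obtain ⟨m, hm, hxm⟩ := (hco.eq_top_or_exists_le_coatom x).resolve_left (by
    rwa [← IsMultiplicativeLattice.one_eq_top])
  refine ⟨m, ⟨by rw [IsMultiplicativeLattice.one_eq_top]; exact hm.1, fun y hy hmy => ?_⟩, hxm⟩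
  rcases hmy.eq_or_lt with h | h
  · exact h.ge
  · exact absurd (hm.2 y h) (by rwa [IsMultiplicativeLattice.one_eq_top] at hy)

theorem eq_one_of_forall_maximal {x : L} (h : ∀ m, IsMaximalElement m → ¬ x ≤ m) : x = 1 := by
  by_contra hx
  obtain ⟨m, hm, hxm⟩ := exists_isMaximalElement_ge hx
  exact h m hm hxm

theorem LocLE.exists_compact {m a b : L} (h : LocLE m a b) :
    ∃ t, IsCompactElement t ∧ ¬ t ≤ m ∧ t * a ≤ b := by
  obtain ⟨t, ht, hab⟩ := h
  obtain ⟨c, hc, hct, hcm⟩ := exists_compact_not_le ht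
  exact ⟨c, hc, hcm, (mul_le_mul_left hct a).trans hab⟩

/-- An element that lies above no member of a multiplicative set of compact elements is below a
prime with the same property. -/
theorem exists_isLPrime_ge {x : L} (S : Set L) (hne : S.Nonempty)
    (hS : ∀ s ∈ S, IsCompactElement s) (hmul : ∀ s ∈ S, ∀ t ∈ S, s * t ∈ S)
    (hx : ∀ s ∈ S, ¬ s ≤ x) : ∃ q, IsLPrime q ∧ x ≤ q ∧ ∀ s ∈ S, ¬ s ≤ q := by
  obtain ⟨q, hxq, hq⟩ := zorn_le_nonempty₀ {z : L | ∀ s ∈ S, ¬ s ≤ z} (fun c hc hch y hy => by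
    refine ⟨sSup c, fun s hs hsc => ?_, fun z hz => le_sSup hz⟩
    obtain ⟨z, hz, hsz⟩ := hS s hs c _ ⟨y, hy⟩ hch.directedOn (isLUB_sSup c) hsc
    exact hc hz s hs hsz) x hx
  have key : ∀ a, ¬ a ≤ q → ∃ s ∈ S, s ≤ q ⊔ a := fun a ha => by
    by_contra! H
    exact ha (le_sup_right.trans (hq.2 H le_sup_left))
  refine ⟨q, ⟨?_, fun a b hab => ?_⟩, hxq, hq.1⟩
  · rintro rfl
    obtain ⟨s, hs⟩ := hne
    exact hq.1 s hs (le_one_of_top s)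
  · by_contra! H
    obtain ⟨s, hs, hsa⟩ := key a H.1
    obtain ⟨t, ht, htb⟩ := key b H.2
    refine hq.1 _ (hmul s hs t ht) ((mul_le_mul' hsa htb).trans ?_)
    rw [sup_mul_eq, mul_sup_eq a]
    exact sup_le (mul_le_left_self _ _) (sup_le (mul_le_right_self _ _) hab)

/-- If `p` is a prime minimal over `x`, then some power of a compact element below `p` is locally
below `x`. -/
theorem exists_locLE_pow {p x c : L} (hp : IsLPrime p)
    (hmin : ∀ q, IsLPrime q → x ≤ q → q ≤ p → p ≤ q) (hc : IsCompactElement c) (hcp : c ≤ p) :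
    ∃ n : ℕ, LocLE p (c ^ n) x := by
  by_contra! H
  -- A prime avoiding all `t * c ^ n` lies below `p` (take `n = 0`) but not above `c` (take `t =
  -- 1`), against minimality of `p`.
  obtain ⟨q, hq, hxq, hqS⟩ := exists_isLPrime_ge (x := x)
    {s | ∃ t, IsCompactElement t ∧ ¬ t ≤ p ∧ ∃ n : ℕ, s = t * c ^ n}
    ⟨1, 1, isCompactElement_one, hp.one_not_le, 0, by simp⟩
    (by
      rintro _ ⟨t, ht, -, n, rfl⟩
      exact IsCompactElement.mul ht (IsCompactElement.pow hc n))
    (by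
      rintro _ ⟨t, ht, htp, n, rfl⟩ _ ⟨u, hu, hup, k, rfl⟩
      exact ⟨t * u, IsCompactElement.mul ht hu, hp.not_mul_le htp hup, n + k,
        by rw [pow_add, mul_mul_mul_comm]⟩)
    (by
      rintro _ ⟨t, ht, htp, n, rfl⟩ h
      exact H n ⟨t, htp, h⟩)
  have hqp : q ≤ p := le_of_forall_compact fun t ht htq => by
    by_contra htp
    exact hqS t ⟨t, ht, htp, 0, by simp⟩ htq
  exact hqS c ⟨1, isCompactElement_one, hp.one_not_le, 1, by simp⟩
    (hcp.trans (hmin q hq hxq hqp))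

/-- If `p` is a prime minimal over `x`, then compact elements below `p` are locally below any
radical element above `x`. -/
theorem IsLRadical.locLE {p x b c : L} (hb : IsLRadical b) (hxb : x ≤ b) (hp : IsLPrime p)
    (hmin : ∀ q, IsLPrime q → x ≤ q → q ≤ p → p ≤ q) (hc : IsCompactElement c) (hcp : c ≤ p) :
    LocLE p c b := by
  obtain ⟨n, t, ht, htc⟩ := exists_locLE_pow hp hmin hc hcp
  -- The exponent `n + 1` guarantees a factor `t`: `(tc)^(n+1) = (t^n c)(t c^n)`, even when `n = 0`.
  refine ⟨t, ht, hb.le_of_pow_le (n := n + 1) ?_⟩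
  rw [mul_pow, pow_succ t, pow_succ' c, mul_mul_mul_comm]
  exact (mul_le_right_self _ _).trans (htc.trans hxb)

theorem exists_minimal_isLPrime {p x : L} (hp : IsLPrime p) (hxp : x ≤ p) :
    ∃ m, IsLPrime m ∧ x ≤ m ∧ m ≤ p ∧ ∀ q, IsLPrime q → x ≤ q → q ≤ m → m ≤ q := by
  obtain ⟨m, hmp, hm⟩ := zorn_le_nonempty₀ (α := Lᵒᵈ)
    {q | IsLPrime (OrderDual.ofDual q) ∧ x ≤ OrderDual.ofDual q} (fun c hc hch y hy => by
    refine ⟨OrderDual.toDual (sInf (OrderDual.ofDual '' c)), ⟨⟨fun h => ?_, fun a b hab => ?_⟩, ?_⟩,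
      fun z hz => ?_⟩
    · exact (hc hy).1.one_not_le (h.ge.trans (sInf_le ⟨y, hy, rfl⟩))
    · by_contra! H
      simp only [OrderDual.ofDual_toDual, le_sInf_iff, not_forall] at H hab
      obtain ⟨⟨_, ⟨q, hq, rfl⟩, hqa⟩, ⟨_, ⟨r, hr, rfl⟩, hrb⟩⟩ := H
      rcases hch.total hq hr with h | h
      · have h' : OrderDual.ofDual r ≤ OrderDual.ofDual q := h
        exact (hc hr).1.not_mul_le (fun h => hqa (h.trans h')) hrb (hab _ ⟨r, hr, rfl⟩)
      · have h' : OrderDual.ofDual q ≤ OrderDual.ofDual r := h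
        exact (hc hq).1.not_mul_le hqa (fun h => hrb (h.trans h')) (hab _ ⟨q, hq, rfl⟩)
    · refine le_sInf ?_
      rintro _ ⟨q, hq, rfl⟩
      exact (hc hq).2
    · exact sInf_le (α := L) ⟨z, hz, rfl⟩) (OrderDual.toDual p) ⟨hp, hxp⟩
  exact ⟨OrderDual.ofDual m, hm.1.1, hm.1.2, hmp, fun q hq hxq hqm =>
    hm.2 (y := OrderDual.toDual q) ⟨hq, hxq⟩ hqm⟩

end Domain

/-! ### Radical factorial lattices have dimension at most one. -/

section RadicalFactorial

variable {L : Type*} [CommMonoid L] [CompleteLattice L] [IsPrincipalCLatticeDomain L]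

open IsPrincipalCLatticeDomain

theorem LocLE.one_right {m a : L} (hm : IsLPrime m) : LocLE m a 1 :=
  .of_le hm (le_one_of_top a)

theorem le_sSup_principal_le (x : L) : x ≤ sSup {a | IsLPrincipal a ∧ a ≤ x} := by
  obtain ⟨S, hS, hx⟩ := principallyGenerated x
  conv_lhs => rw [hx]
  exact sSup_le_sSup fun s hs => ⟨hS s hs, hx.ge.trans' (le_sSup hs)⟩

theorem le_sSup_compact_le (x : L) : x ≤ sSup {a | IsCompactElement a ∧ a ≤ x} :=
  (sSup_compact_le_eq x).ge

/-- If `m` is locally idempotent, the elements that are locally above `m` are closed under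
products. -/
theorem forall_locLE_mul {m a b : L} (hm : IsLPrime m)
    (hid : ∀ c, IsCompactElement c → c ≤ m → LocLE m c (m * m))
    (ha : ∀ c, IsCompactElement c → c ≤ m → LocLE m c a)
    (hb : ∀ c, IsCompactElement c → c ≤ m → LocLE m c b) :
    ∀ c, IsCompactElement c → c ≤ m → LocLE m c (a * b) := by
  intro c hc hcm
  obtain ⟨t, ht, htm, htc⟩ := (hid c hc hcm).exists_compact
  refine LocLE.trans hm ⟨t, htm, le_rfl⟩ (.of_le_sSup hm (IsCompactElement.mul ht hc)
    (S := {x | ∃ u v, (IsCompactElement u ∧ u ≤ m) ∧ (IsCompactElement v ∧ v ≤ m) ∧ x = u * v})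
    (htc.trans ?_) ?_)
  · refine (mul_le_mul' (le_sSup_compact_le m) (le_sSup_compact_le m)).trans ?_
    rw [sSup_mul_distrib]
    refine iSup₂_le fun u hu => ?_
    rw [mul_sSup_distrib]
    exact iSup₂_le fun v hv => le_sSup ⟨u, v, hu, hv, rfl⟩
  · rintro _ ⟨u, v, hu, hv, rfl⟩
    exact .mul hm (ha u hu.1 hu.2) (hb v hv.1 hv.2)

/-- In a radical factorial lattice, a prime minimal over `p ∨ s`, where `p` is a prime not above
the principal element `s`, is not locally idempotent. -/
theorem exists_isLPrincipal_not_locLE_sq (h : IsRadicalFactorial L) {p m s : L}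
    (hp : IsLPrime p) (hm : IsLPrime m) (hs : IsLPrincipal s) (hsp : ¬ s ≤ p) (hpm : p ≤ m)
    (hsm : s ≤ m) (hmin : ∀ q, IsLPrime q → p ⊔ s ≤ q → q ≤ m → m ≤ q) :
    ∃ e, IsLPrincipal e ∧ e ≤ m ∧ ¬ LocLE m e (m * m) := by
  by_contra! H
  have hid : ∀ c, IsCompactElement c → c ≤ m → LocLE m c (m * m) := fun c hc hcm =>
    .of_le_sSup hm hc (le_sSup_principal_le c) fun e he => H e he.1 (he.2.trans hcm)
  -- Each radical factor lies above `p ∨ s`, hence locally above `m`; by local idempotence so does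
  -- the product. Thus `s` is locally below `p ∨ s²`, and cancelling `s` is absurd.
  obtain ⟨n, f, -, hf, hprod⟩ := h (p ⊔ s * s)
  have hloc : ∀ c, IsCompactElement c → c ≤ m → LocLE m c (∏ i, f i) := by
    refine Finset.prod_induction f (fun x => ∀ c, IsCompactElement c → c ≤ m → LocLE m c x)
      (fun a b ha hb => forall_locLE_mul hm hid ha hb) (fun c _ _ => .one_right hm)
      fun i hi c hc hcm => (hf i).locLE (sup_le ?_ ?_) hm hmin hc hcm
    · exact le_sup_left.trans (hprod.le.trans (by
        rw [← Finset.mul_prod_erase _ f hi]; exact mul_le_left_self _ _))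
    · refine (hf i).le_of_pow_le (n := 2) ?_
      rw [sq]
      exact le_sup_right.trans (hprod.le.trans (by
        rw [← Finset.mul_prod_erase _ f hi]; exact mul_le_left_self _ _))
  obtain ⟨t, htm, hts⟩ := hloc s hs.isCompactElement hsm
  rw [← hprod, sup_comm] at hts
  have h1 : t ≤ s ⊔ residual p s := hs.le_sup_residual hts
  have h2 : residual p s ≤ p := (hp.2 _ _ (residual_mul_le s p)).resolve_right hsp
  exact htm (h1.trans (sup_le hsm (h2.trans hpm)))

/-- In a radical factorial lattice, a principal element that is not locally below `m²` generates
`m` locally. -/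
theorem locLE_of_not_locLE_sq (h : IsRadicalFactorial L) {m e z : L} (hm : IsLPrime m)
    (hem : e ≤ m) (hem2 : ¬ LocLE m e (m * m))
    (hz : IsCompactElement z) (hzm : z ≤ m) : LocLE m z e := by
  refine .of_le_sSup hm hz (le_sSup_principal_le z) fun z ⟨hz, hz'⟩ => ?_
  have hzm := hz'.trans hzm
  obtain ⟨b, c, hb, hbm, hbc⟩ := (h (e ⊔ z * z)).exists_factor hm
    (sup_le hem ((mul_le_left_self z z).trans hzm))
  -- Only one factor can lie below `m`, since otherwise `e ≤ m²`; so `c` is a local unit.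
  have hcm : ¬ c ≤ m := fun hcm => hem2 (.of_le hm
    (le_sup_left.trans (hbc.le.trans (mul_le_mul' hbm hcm))))
  have hzb : z ≤ b := hb.le_of_pow_le (n := 2) (by
    rw [sq]; exact le_sup_right.trans (hbc.le.trans (mul_le_left_self _ _)))
  have hcz : c * z ≤ z * z ⊔ e := by
    rw [sup_comm, hbc, mul_comm]; exact mul_le_mul_left hzb c
  have h1 : c ≤ z ⊔ residual e z := hz.le_sup_residual hcz
  exact ⟨residual e z, fun h2 => hcm (h1.trans (sup_le hzm h2)), residual_mul_le z e⟩

theorem exists_isLInvertible_isLRadical_le {p : L} (hp : IsLPrime p) (h0 : p ≠ ⊥)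
    (h : ∀ x : L, IsLInvertible x → IsProductOfLRadicals x) :
    ∃ y, IsLInvertible y ∧ IsLRadical y ∧ y ≤ p := by
  obtain ⟨a, ha, hap⟩ := exists_isLInvertible_le h0
  obtain ⟨b, c, hb, hbp, rfl⟩ := (h a ha).exists_factor hp hap
  exact ⟨b, ha.of_mul_left, hb, hbp⟩

/-- A locally principal prime of a radical factorial lattice has height at most one. -/
theorem IsRadicalFactorial.le_of_locLE (h : IsRadicalFactorial L) {p m e : L} (hp : IsLPrime p)
    (hm : IsLPrime m) (h0 : p ≠ ⊥) (hpm : p ≤ m) (he : IsLPrincipal e) (hem : e ≤ m)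
    (hloc : ∀ c, IsCompactElement c → c ≤ m → LocLE m c e) : m ≤ p := by
  by_contra hmp
  have hep : ¬ e ≤ p := fun hep => hmp (le_of_forall_compact fun c hc hcm => by
    obtain ⟨t, ht, htc⟩ := hloc c hc hcm
    exact (hp.2 _ _ (htc.trans hep)).resolve_left fun h => ht (h.trans hpm))
  obtain ⟨z, hz, hzr, hzp⟩ := exists_isLInvertible_isLRadical_le hp h0 fun x _ => h x
  obtain ⟨t', ht', ht'z⟩ := hloc z hz.isCompactElement (hzp.trans hpm)
  obtain ⟨t, htpr, htt, htm⟩ := exists_principal_not_le ht'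
  have htz : t * z ≤ e := (mul_le_mul_left htt z).trans ht'z
  have ht : IsLInvertible t := htpr.isLInvertible fun h => htm (h.le.trans bot_le)
  obtain ⟨w, hw⟩ := he.exists_eq_mul htz
  have hwinv : IsLInvertible w := .of_mul_right (a := e) (hw ▸ ht.mul hz)
  have hwp : w ≤ p := (hp.2 e w (hw ▸ (mul_le_right_self t z).trans hzp)).resolve_left hep
  obtain ⟨u, hum, huw⟩ := hloc w hwinv.isCompactElement (hwp.trans hpm)
  obtain ⟨w', hw'⟩ := he.exists_eq_mul huw
  -- With `tz = ew` and `uw = ew'`, the square of `uw` is a multiple of `z`. As `z` is radical, `uw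
  -- ≤ z`; then `z(ut) = e(uw) ≤ ze`, and cancelling `z` puts `ut` below `e`.
  have huwz : u * w ≤ z := hzr.le_of_pow_le (n := 2) (by
    calc (u * w) ^ 2 = u * (u * w * w) := by rw [sq, mul_assoc, mul_left_comm w u w, mul_assoc]
      _ = u * (t * z * w') := by rw [hw', hw, mul_right_comm]
      _ ≤ z := (mul_le_right_self _ _).trans ((mul_le_left_self _ _).trans (mul_le_right_self _ _)))
  have hut : u * t ≤ e := hz.2.le_of_mul_le_mul (by
    calc z * (u * t) = e * (u * w) := by rw [mul_left_comm e u w, ← hw, mul_comm z, mul_assoc]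
      _ ≤ z * e := by rw [mul_comm z]; exact mul_le_mul_right huwz e)
  exact hm.not_mul_le hum htm (hut.trans hem)

/-- The larger prime is replaced by a prime `q` minimal over `p ∨ s`, to which the local idempotence
argument applies. -/
theorem IsRadicalFactorial.isLPrime_le (h : IsRadicalFactorial L) {p m : L} (hp : IsLPrime p)
    (hm : IsLPrime m) (h0 : p ≠ ⊥) (hpm : p ≤ m) : m ≤ p := by
  by_contra hmp
  obtain ⟨s, hs, hsm, hsp⟩ := exists_principal_not_le hmp
  obtain ⟨q, hq, hpsq, -, hmin⟩ := exists_minimal_isLPrime hm (sup_le hpm hsm)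
  have hpq := le_sup_left.trans hpsq
  have hsq := le_sup_right.trans hpsq
  obtain ⟨e, he, heq, he2⟩ := exists_isLPrincipal_not_locLE_sq h hp hq hs hsp hpq hsq hmin
  exact hsp (hsq.trans (h.le_of_locLE hp hq h0 hpq he heq fun c hc hcq =>
    locLE_of_not_locLE_sq h hq heq he2 hc hcq))

theorem dim_le_one_iff :
    dim L ≤ 1 ↔ ∀ p m : L, IsLPrime p → IsLPrime m → p ≠ ⊥ → p ≤ m → m ≤ p := by
  rw [dim, Order.krullDim_le_one_iff]
  constructor
  · intro h p m hp hm h0 hpm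
    rcases h ⟨p, hp⟩ with h | h
    · exact absurd (le_bot_iff.1 (h (b := ⟨⊥, isLPrime_bot⟩) bot_le)) h0
    · exact h (b := ⟨m, hm⟩) hpm
  · rintro h ⟨p, hp⟩
    by_cases h0 : p = ⊥
    · exact .inl fun q _ => h0.le.trans bot_le
    · exact .inr fun q hpq => h p q hp q.2 h0 hpq

theorem IsRadicalFactorial.dim_le_one (h : IsRadicalFactorial L) : dim L ≤ 1 :=
  dim_le_one_iff.2 fun _ _ hp hm h0 hpm => h.isLPrime_le hp hm h0 hpm

theorem isMaximalElement_of_dim_le_one (h : dim L ≤ 1) {p : L} (hp : IsLPrime p) (h0 : p ≠ ⊥) :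
    IsMaximalElement p := by
  obtain ⟨m, hm, hpm⟩ := exists_isMaximalElement_ge hp.1
  rwa [le_antisymm hpm (dim_le_one_iff.1 h p m hp hm.isLPrime h0 hpm)]

end RadicalFactorial

/-! ### Local uniformizers and invertibility of radicals. -/

section DimensionOne

/-- Every nonzero prime is maximal and lies above an invertible radical element. -/
def HasRadicalUniformizers (L : Type*) [CommMonoid L] [CompleteLattice L] : Prop :=
  ∀ p : L, IsLPrime p → p ≠ ⊥ →
    IsMaximalElement p ∧ ∃ y : L, IsLInvertible y ∧ IsLRadical y ∧ y ≤ p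

theorem HasRadicalUniformizers.minimal {L : Type*} [CommMonoid L] [CompleteLattice L]
    (h : HasRadicalUniformizers L) {p x : L} (hp : IsLPrime p) (hx : x ≠ ⊥) :
    ∀ q, IsLPrime q → x ≤ q → q ≤ p → p ≤ q :=
  fun q hq hxq hqp => (h q hq fun h0 => hx (le_bot_iff.1 (hxq.trans h0.le))).1.2 hp.1 hqp

variable {L : Type*} [CommMonoid L] [CompleteLattice L] [IsPrincipalCLatticeDomain L]

open IsPrincipalCLatticeDomain

theorem HasRadicalUniformizers.locLE_of_isLRadical (h : HasRadicalUniformizers L) {p y c : L}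
    (hp : IsLPrime p) (hy : y ≠ ⊥) (hyr : IsLRadical y) (hc : IsCompactElement c) (hcp : c ≤ p) :
    LocLE p c y :=
  hyr.locLE le_rfl hp (h.minimal hp hy) hc hcp

/-- Locally, every nonzero compact element is a power of the uniformizer. -/
theorem HasRadicalUniformizers.exists_locLE_pow (h : HasRadicalUniformizers L) {p y a : L}
    (hp : IsLPrime p) (hy : IsLInvertible y) (hyr : IsLRadical y) (hyp : y ≤ p)
    (ha : IsCompactElement a) (h0 : a ≠ ⊥) :
    ∃ k : ℕ, LocLE p a (y ^ k) ∧ LocLE p (y ^ k) a := by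
  -- This makes the valuation of `a` finite: some `y ^ n` is locally below `a`, so `a` locally below
  -- `y ^ (n + 1)` would make `y` a local unit.
  have hfail : ∃ n : ℕ, ¬ LocLE p a (y ^ n) := by
    by_cases hap : a ≤ p
    · obtain ⟨n, hn⟩ := MultLattice.exists_locLE_pow hp (h.minimal hp h0) hy.isCompactElement hyp
      refine ⟨n + 1, fun hn1 => ?_⟩
      obtain ⟨t, ht, hty⟩ := hn.trans hp hn1
      rw [mul_comm, pow_succ] at hty
      exact ht (((hy.pow n).2.le_of_mul_le_mul hty).trans hyp)
    · refine ⟨1, fun ⟨t, ht, hta⟩ => hp.not_mul_le ht hap (hta.trans ?_)⟩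
      simpa using hyp
  classical
  obtain ⟨k, hk⟩ : ∃ k, Nat.find hfail = k + 1 := Nat.exists_eq_succ_of_ne_zero fun h0 => by
    have := Nat.find_spec hfail
    rw [h0, pow_zero] at this
    exact this (.one_right hp)
  have hak : LocLE p a (y ^ k) := not_not.1 (Nat.find_min hfail (by omega))
  have hak1 : ¬ LocLE p a (y ^ (k + 1)) := hk ▸ Nat.find_spec hfail
  refine ⟨k, hak, ?_⟩
  obtain ⟨s, hs, hsp, hsa⟩ := hak.exists_compact
  obtain ⟨b, hb⟩ := (hy.pow k).1.exists_eq_mul hsa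
  have hbc : IsCompactElement b :=
    isCompactElement_of_mul (hy.pow k).2 (hb ▸ IsCompactElement.mul hs ha)
  -- The cofactor `b` in `sa = y ^ k b` is a local unit: were it below `p`, it would be locally
  -- below `y`, against maximality of `k`.
  refine ⟨b, fun hbp => hak1 ?_, ?_⟩
  · have h1 : LocLE p (y ^ k * b) (y ^ k * y) := .mul hp (.of_le hp le_rfl)
      (h.locLE_of_isLRadical hp hy.ne_bot hyr hbc hbp)
    rw [← hb, ← pow_succ] at h1
    exact LocLE.trans hp ⟨s, hsp, le_rfl⟩ h1
  · rw [mul_comm, ← hb]; exact mul_le_right_self s a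

theorem HasRadicalUniformizers.locLE_total (h : HasRadicalUniformizers L) {p a b : L}
    (hp : IsLPrime p) (ha : IsCompactElement a) (ha0 : a ≠ ⊥) (hb : IsCompactElement b)
    (hb0 : b ≠ ⊥) : LocLE p a b ∨ LocLE p b a := by
  by_cases h0 : p = ⊥
  -- At the zero prime every nonzero element is a local unit, so `b` itself serves as denominator.
  · exact .inl ⟨b, fun hbp => hb0 (le_bot_iff.1 (hbp.trans h0.le)), mul_le_left_self b a⟩
  obtain ⟨-, y, hy, hyr, hyp⟩ := h p hp h0
  obtain ⟨k, hak, hka⟩ := h.exists_locLE_pow hp hy hyr hyp ha ha0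
  obtain ⟨l, hbl, hlb⟩ := h.exists_locLE_pow hp hy hyr hyp hb hb0
  have hpow : ∀ {i j : ℕ}, i ≤ j → LocLE p (y ^ j) (y ^ i) := fun hij =>
    .of_le hp (pow_le_pow_right_of_le_one' (le_one_of_top y) hij)
  rcases le_total k l with hkl | hkl
  · exact .inr (hbl.trans hp ((hpow hkl).trans hp hka))
  · exact .inl (hak.trans hp ((hpow hkl).trans hp hlb))

theorem HasRadicalUniformizers.residual_sup_residual (h : HasRadicalUniformizers L) {a b : L}
    (ha : IsCompactElement a) (ha0 : a ≠ ⊥) (hb : IsCompactElement b) (hb0 : b ≠ ⊥) :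
    residual a b ⊔ residual b a = 1 := by
  refine eq_one_of_forall_maximal fun m hm hle => ?_
  rcases h.locLE_total hm.isLPrime ha ha0 hb hb0 with ⟨t, ht, hta⟩ | ⟨t, ht, hta⟩
  · exact ht ((le_residual.2 hta).trans (le_sup_right.trans hle))
  · exact ht ((le_residual.2 hta).trans (le_sup_left.trans hle))

theorem sup_mul_inf_eq {a b : L} (h : residual a b ⊔ residual b a = 1) :
    (a ⊔ b) * (a ⊓ b) = a * b := by
  refine le_antisymm ?_ ?_
  · rw [sup_mul_eq]
    refine sup_le (mul_le_mul_right inf_le_right a) ?_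
    rw [mul_comm a b]
    exact mul_le_mul_right inf_le_left b
  · have h1 : residual a b * b ≤ a ⊓ b := le_inf (residual_mul_le _ _) (mul_le_right_self _ _)
    have h2 : residual b a * a ≤ a ⊓ b := le_inf (mul_le_right_self _ _) (residual_mul_le _ _)
    calc a * b = a * (residual a b * b) ⊔ b * (residual b a * a) := by
          rw [mul_left_comm a, mul_left_comm b, mul_comm b a, ← sup_mul_eq, h, one_mul]
      _ ≤ (a ⊔ b) * (a ⊓ b) := by
          rw [sup_mul_eq]
          exact sup_le_sup (mul_le_mul_right h1 a) (mul_le_mul_right h2 b)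

/-- Both factors inherit invertibility: the join is used for compact elements, the meet for
combining uniformizers. -/
theorem HasRadicalUniformizers.isLInvertible_sup_mul_inf (h : HasRadicalUniformizers L) {a b : L}
    (ha : IsLInvertible a) (hb : IsLInvertible b) : IsLInvertible ((a ⊔ b) * (a ⊓ b)) := by
  rw [sup_mul_inf_eq (h.residual_sup_residual ha.isCompactElement ha.ne_bot
    hb.isCompactElement hb.ne_bot)]
  exact ha.mul hb

theorem HasRadicalUniformizers.isLInvertible (h : HasRadicalUniformizers L) {x : L}
    (hx : IsCompactElement x) (h0 : x ≠ ⊥) : IsLInvertible x := by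
  classical
  obtain ⟨S, hS, hxS⟩ := principallyGenerated x
  obtain ⟨t, ht, hxt⟩ :=
    (CompleteLattice.isCompactElement_iff_exists_le_sSup_of_le_sSup _ x).1 hx S hxS.le
  have hx' : x = t.sup id := le_antisymm hxt (by
    rw [hxS]; exact Finset.sup_le fun i hi => le_sSup (ht hi))
  have key : t.sup id = ⊥ ∨ IsLInvertible (t.sup id) := by
    refine Finset.sup_induction (p := fun y => y = ⊥ ∨ IsLInvertible y) (.inl rfl) ?_ ?_
    · rintro a (rfl | ha) b (rfl | hb)
      · exact .inl (by simp)
      · exact .inr (by simpa using hb)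
      · exact .inr (by simpa using ha)
      · exact .inr (h.isLInvertible_sup_mul_inf ha hb).of_mul_left
    · exact fun i hi => or_iff_not_imp_left.2 (hS i (ht hi)).isLInvertible
  exact hx' ▸ key.resolve_left (hx' ▸ h0)

/-- A nonzero compact element lies above a power of an invertible radical element. -/
theorem HasRadicalUniformizers.exists_isLRadical_pow_le (h : HasRadicalUniformizers L) {x : L}
    (hx : x ≠ ⊥) : ∃ y : L, IsLInvertible y ∧ IsLRadical y ∧ ∃ n : ℕ, y ^ n ≤ x := by
  -- Members of `T` are denominators witnessing the claim locally; meets of uniformizers make `T`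
  -- directed, so compactness of `1` puts a global witness in it.
  let T : Set L := {t | ∃ y : L, IsLInvertible y ∧ IsLRadical y ∧ ∃ n : ℕ, t * y ^ n ≤ x}
  have hxT : x ∈ T := ⟨1, isLInvertible_one, isLRadical_one, 0, by simp⟩
  have hdir : DirectedOn (· ≤ ·) T := by
    rintro t ⟨y, hy, hyr, n, hty⟩ u ⟨z, hz, hzr, k, huz⟩
    refine ⟨t ⊔ u, ⟨y ⊓ z, (h.isLInvertible_sup_mul_inf hy hz).of_mul_right, hyr.inf hzr, n + k,
      ?_⟩, le_sup_left, le_sup_right⟩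
    rw [sup_mul_eq]
    refine sup_le ((mul_le_mul_right ?_ t).trans hty) ((mul_le_mul_right ?_ u).trans huz)
    · rw [pow_add]; exact (mul_le_left_self _ _).trans (pow_le_pow_left' inf_le_left n)
    · rw [pow_add]; exact (mul_le_right_self _ _).trans (pow_le_pow_left' inf_le_right k)
  have hT : sSup T = 1 := eq_one_of_forall_maximal fun m hm hle => by
    have hxm : x ≤ m := (le_sSup hxT).trans hle
    obtain ⟨-, y, hy, hyr, hym⟩ := h m hm.isLPrime (ne_bot_of_le_ne_bot hx hxm)
    obtain ⟨n, t, htm, hty⟩ := MultLattice.exists_locLE_pow hm.isLPrime (h.minimal hm.isLPrime hx)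
      hy.isCompactElement hym
    exact htm ((le_sSup (s := T) ⟨y, hy, hyr, n, hty⟩).trans hle)
  obtain ⟨t, ⟨y, hy, hyr, n, hty⟩, h1⟩ :=
    isCompactElement_one T (sSup T) ⟨x, hxT⟩ hdir (isLUB_sSup T) hT.ge
  exact ⟨y, hy, hyr, n, by simpa using (mul_le_mul_left h1 (y ^ n)).trans hty⟩

theorem HasRadicalUniformizers.isLInvertible_radical (h : HasRadicalUniformizers L) {x : L}
    (hx : IsCompactElement x) (h0 : x ≠ ⊥) : IsLInvertible (radical x) := by
  obtain ⟨y, hy, hyr, n, hyx⟩ := h.exists_isLRadical_pow_le h0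
  have hrad : radical x = x ⊔ y := by
    refine le_antisymm (le_of_forall_compact fun c hc hcx => ?_)
      (sup_le (le_radical x) (le_radical_of_pow_le hyx))
    obtain ⟨k, hk⟩ := exists_pow_le_of_le_radical hc hcx
    -- The inequality `c ≤ x ∨ y` is checked locally: at a maximal `m` above `x`, the element `c` is
    -- already locally below `y`.
    have hres : residual (x ⊔ y) c = 1 := eq_one_of_forall_maximal fun m hm hle => by
      have hxm : x ≤ m := le_sup_left.trans ((self_le_residual c (x ⊔ y)).trans hle)
      obtain ⟨t, ht, htc⟩ := h.locLE_of_isLRadical hm.isLPrime hy.ne_bot hyr hc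
        (hm.isLPrime.le_of_pow_le (hk.trans hxm))
      exact ht ((le_residual.2 (htc.trans le_sup_right)).trans hle)
    simpa using le_residual.1 hres.ge
  rw [hrad]
  exact h.isLInvertible (IsCompactElement.sup hx hy.isCompactElement)
    (ne_bot_of_le_ne_bot h0 le_sup_left)

end DimensionOne

/-! ### Factorization when radicals of compact elements are invertible. -/

section InvertibleRadicals

variable {L : Type*} [CommMonoid L] [CompleteLattice L] [IsPrincipalCLatticeDomain L]

variable (L) in
/-- The radicals of nonzero compact elements are invertible. -/
def HasInvertibleRadicals : Prop :=
  ∀ x : L, IsCompactElement x → x ≠ ⊥ → IsLInvertible (radical x)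

/-- The cofactor of `√x` in `x`. -/
def radicalCofactor (x : L) : L := residual x (radical x)

theorem HasInvertibleRadicals.radical_mul_cofactor (h : HasInvertibleRadicals L) {x : L}
    (hx : IsCompactElement x) (h0 : x ≠ ⊥) : radical x * radicalCofactor x = x := by
  rw [mul_comm]; exact (h x hx h0).1.residual_mul (le_radical x)

theorem le_radicalCofactor (x : L) : x ≤ radicalCofactor x := self_le_residual _ _

theorem HasInvertibleRadicals.isCompactElement_cofactor (h : HasInvertibleRadicals L) {x : L}
    (hx : IsCompactElement x) (h0 : x ≠ ⊥) : IsCompactElement (radicalCofactor x) :=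
  isCompactElement_of_mul (h x hx h0).2 (by rwa [h.radical_mul_cofactor hx h0])

theorem HasInvertibleRadicals.exists_radical_pow_le (h : HasInvertibleRadicals L) {x : L}
    (hx : IsCompactElement x) (h0 : x ≠ ⊥) : ∃ n : ℕ, radical x ^ n ≤ x :=
  exists_pow_le_of_le_radical (h x hx h0).isCompactElement le_rfl

/-- Factors of an invertible radical element are comaximal. -/
theorem HasInvertibleRadicals.sup_eq_one_of_mul (h : HasInvertibleRadicals L) {a b : L}
    (hab : IsLInvertible (a * b)) (hr : IsLRadical (a * b)) : a ⊔ b = 1 := by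
  have ha : IsLInvertible a := hab.of_mul_left
  have hb : IsLInvertible b := hab.of_mul_right
  have hc : IsCompactElement (a ⊔ b) := IsCompactElement.sup ha.isCompactElement hb.isCompactElement
  have h0 : a ⊔ b ≠ ⊥ := ne_bot_of_le_ne_bot ha.ne_bot le_sup_left
  have hinv := h _ hc h0
  have har : a ≤ radical (a ⊔ b) := le_sup_left.trans (le_radical _)
  have hbr : b ≤ radical (a ⊔ b) := le_sup_right.trans (le_radical _)
  suffices hr1 : 1 ≤ radical (a ⊔ b) by
    obtain ⟨n, hn⟩ := exists_pow_le_of_le_radical isCompactElement_one hr1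
    exact le_antisymm (le_one_of_top _) (by simpa using hn)
  generalize radical (a ⊔ b) = r at hinv har hbr
  obtain ⟨a', rfl⟩ := hinv.1.exists_eq_mul har
  obtain ⟨b', rfl⟩ := hinv.1.exists_eq_mul hbr
  have e : r * a' * (r * b') = r * a' * b' * r := by rw [mul_assoc _ b', mul_comm r b']
  rw [e] at hab hr
  -- The product is `(r a' b') r`, which is radical and lies above `(r a' b')²`; cancelling `r a'
  -- b'` forces `r = 1`.
  have hle : r * a' * b' ≤ r * a' * b' * r := hr.le_of_pow_le (n := 2) (by
    rw [sq, mul_assoc r]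
    exact mul_le_mul_right (mul_le_left_self _ _) _)
  exact hab.of_mul_left.2.le_of_mul_le_mul (by rwa [mul_one])

theorem HasInvertibleRadicals.exists_radical_eq_mul (h : HasInvertibleRadicals L) {c d : L}
    (hc : IsCompactElement c) (hc0 : c ≠ ⊥) (hd : IsCompactElement d) (hcd : c ≤ d) :
    ∃ w, radical c = radical d * w ∧ w ⊔ d = 1 := by
  have hd0 := ne_bot_of_le_ne_bot hc0 hcd
  obtain ⟨w, hw⟩ := (h d hd hd0).1.exists_eq_mul (radical_mono hcd)
  refine ⟨w, hw, le_antisymm (le_one_of_top _) ?_⟩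
  have h1 : radical d ⊔ w = 1 := h.sup_eq_one_of_mul (hw ▸ h c hc hc0)
    (hw ▸ isLRadical_radical c)
  obtain ⟨n, hn⟩ := h.exists_radical_pow_le hd hd0
  rw [← pow_sup_pow_eq_one (sup_comm (radical d) w ▸ h1) 1 n, pow_one]
  exact sup_le_sup_left hn w

/-- Cancelling `√d` leaves the cofactor of `c` times `w` below that of `d`; `w` is comaximal with
`d`, hence with its cofactor, and can be dropped. -/
theorem HasInvertibleRadicals.cofactor_mono (h : HasInvertibleRadicals L) {c d : L}
    (hc : IsCompactElement c) (hc0 : c ≠ ⊥) (hd : IsCompactElement d) (hcd : c ≤ d) :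
    radicalCofactor c ≤ radicalCofactor d := by
  have hd0 := ne_bot_of_le_ne_bot hc0 hcd
  obtain ⟨w, hw, hwd⟩ := h.exists_radical_eq_mul hc hc0 hd hcd
  have hle : radical d * (radicalCofactor c * w) ≤ radical d * radicalCofactor d := by
    rw [h.radical_mul_cofactor hd hd0, mul_comm _ w, ← mul_assoc, ← hw,
      h.radical_mul_cofactor hc hc0]
    exact hcd
  refine eq_of_mul_le_of_sup_eq_one (le_antisymm (le_one_of_top _) ?_)
    ((h d hd hd0).2.le_of_mul_le_mul hle)
  rw [← hwd]
  exact sup_le_sup_left (le_radicalCofactor d) w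

/-- The drop in exponent drives the inductions on `n`: one `√c` cancels, and the comaximal quotient
`w` of the two radicals is discarded. -/
theorem HasInvertibleRadicals.radical_cofactor_pow_le (h : HasInvertibleRadicals L) {c : L}
    (hc : IsCompactElement c) (hc0 : c ≠ ⊥) {n : ℕ} (hn : radical c ^ (n + 1) ≤ c) :
    radical (radicalCofactor c) ^ n ≤ radicalCofactor c := by
  have hle : radical c ^ n ≤ radicalCofactor c := (h c hc hc0).2.le_of_mul_le_mul (by
    rwa [h.radical_mul_cofactor hc hc0, ← pow_succ'])
  obtain ⟨w, hw, hwd⟩ := h.exists_radical_eq_mul hc hc0 (h.isCompactElement_cofactor hc hc0)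
    (le_radicalCofactor c)
  refine eq_of_mul_le_of_sup_eq_one (w := w ^ n) ?_ (by rwa [← mul_pow, ← hw])
  simpa using pow_sup_pow_eq_one hwd n 1

theorem HasInvertibleRadicals.isLInvertible (h : HasInvertibleRadicals L) {x : L}
    (hx : IsCompactElement x) (h0 : x ≠ ⊥) : IsLInvertible x := by
  obtain ⟨n, hn⟩ := h.exists_radical_pow_le hx h0
  induction n generalizing x with
  | zero =>
    rw [le_antisymm (le_one_of_top x) (by simpa using hn)]
    exact isLInvertible_one
  | succ n ih =>
    rw [← h.radical_mul_cofactor hx h0]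
    exact (h x hx h0).mul (ih (h.isCompactElement_cofactor hx h0)
      (ne_bot_of_le_ne_bot h0 (le_radicalCofactor x)) (h.radical_cofactor_pow_le hx h0 hn))

theorem radical_bot : radical (⊥ : L) = ⊥ := isLRadical_bot

theorem HasInvertibleRadicals.isCompactElement_radical (h : HasInvertibleRadicals L) {x : L}
    (hx : IsCompactElement x) : IsCompactElement (radical x) := by
  by_cases h0 : x = ⊥
  · rwa [h0, radical_bot, ← h0]
  · exact (h x hx h0).isCompactElement

/-- The factorization `x = √x · ⋁ (c : √c)`, where `c` runs over the nonzero compact elements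
below `x`. -/
theorem HasInvertibleRadicals.radical_mul_sSup (h : HasInvertibleRadicals L) (x : L) :
    radical x * sSup (radicalCofactor '' {c | IsCompactElement c ∧ c ≠ ⊥ ∧ c ≤ x}) = x := by
  refine le_antisymm (le_residual.1 (le_of_forall_compact fun a ha hax => le_residual.2 ?_))
    (le_of_forall_compact fun c hc hcx => ?_)
  · rw [mul_sSup_distrib]
    refine iSup₂_le ?_
    rintro _ ⟨c, ⟨hc, hc0, hcx⟩, rfl⟩
    obtain ⟨n, hn⟩ := exists_pow_le_of_le_radical ha hax
    -- The compact element `a ^ n ∨ c ≤ x` dominates both factors at once: its radical lies above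
    -- `a`, its cofactor above that of `c`.
    have hd : IsCompactElement (a ^ n ⊔ c) := IsCompactElement.sup (IsCompactElement.pow ha n) hc
    have hd0 : a ^ n ⊔ c ≠ ⊥ := ne_bot_of_le_ne_bot hc0 le_sup_right
    calc a * radicalCofactor c
        ≤ radical (a ^ n ⊔ c) * radicalCofactor (a ^ n ⊔ c) :=
          mul_le_mul' (le_radical_of_pow_le le_sup_left) (h.cofactor_mono hc hc0 hd le_sup_right)
      _ ≤ x := (h.radical_mul_cofactor hd hd0).trans_le (sup_le hn hcx)
  · by_cases hc0 : c = ⊥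
    · exact hc0.le.trans bot_le
    · conv_lhs => rw [← h.radical_mul_cofactor hc hc0]
      exact mul_le_mul' (radical_mono hcx) (le_sSup ⟨c, ⟨hc, hc0, hcx⟩, rfl⟩)

/-- The compact `c` below `x` supplies the exponent for the induction, as `x` itself need not be
compact. The bound `radical x ≤ f i` lets `√x` be prepended while keeping the chain increasing. -/
theorem HasInvertibleRadicals.exists_chain (h : HasInvertibleRadicals L) {x c : L}
    (hc : IsCompactElement c) (hc0 : c ≠ ⊥) (hcx : c ≤ x) {n : ℕ} (hn : radical c ^ n ≤ c) :
    ∃ (k : ℕ) (f : Fin k → L), 1 ≤ k ∧ Monotone f ∧ (∀ i, IsLRadical (f i)) ∧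
      (∀ i, radical x ≤ f i) ∧ x = ∏ i, f i := by
  induction n generalizing x c with
  | zero =>
    have hx : x = 1 := le_antisymm (le_one_of_top x) ((by simpa using hn : 1 ≤ c).trans hcx)
    exact ⟨1, fun _ => 1, le_rfl, monotone_const, fun _ => isLRadical_one,
      fun _ => le_one_of_top _, by simpa using hx⟩
  | succ n ih =>
    have hx := h.radical_mul_sSup x
    set x' := sSup (radicalCofactor '' {c | IsCompactElement c ∧ c ≠ ⊥ ∧ c ≤ x})
    obtain ⟨k, f, -, hmono, hrad, hle, hprod⟩ := ih (h.isCompactElement_cofactor hc hc0)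
      (ne_bot_of_le_ne_bot hc0 (le_radicalCofactor c)) (x := x') (le_sSup ⟨c, ⟨hc, hc0, hcx⟩, rfl⟩)
      (h.radical_cofactor_pow_le hc hc0 hn)
    have hxx' : x ≤ x' := hx.ge.trans (mul_le_right_self _ _)
    have hle' : ∀ i, radical x ≤ f i := fun i => (radical_mono hxx').trans (hle i)
    refine ⟨k + 1, Fin.cons (radical x) f, by omega, fun i j hij => ?_, fun i => ?_, fun i => ?_,
      ?_⟩
    · cases i using Fin.cases with
      | zero => cases j using Fin.cases with
        | zero => exact le_rfl
        | succ j => exact hle' j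
      | succ i => cases j using Fin.cases with
        | zero => exact absurd hij (by simp)
        | succ j => exact hmono (Fin.succ_le_succ_iff.1 hij)
    · cases i using Fin.cases with
      | zero => exact isLRadical_radical x
      | succ i => exact hrad i
    · cases i using Fin.cases with
      | zero => exact le_rfl
      | succ i => exact hle' i
    · rw [Fin.prod_univ_succ]
      simp only [Fin.cons_zero, Fin.cons_succ]
      rw [← hprod, hx]

theorem HasInvertibleRadicals.isProductOfLRadicalChain (h : HasInvertibleRadicals L) (x : L) :
    IsProductOfLRadicalChain x := by
  by_cases h0 : x = ⊥
  · exact ⟨1, fun _ => x, le_rfl, monotone_const, fun _ => h0 ▸ isLRadical_bot, by simp⟩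
  · obtain ⟨c, hc, hcx⟩ := exists_isLInvertible_le h0
    obtain ⟨n, hn⟩ := h.exists_radical_pow_le hc.isCompactElement hc.ne_bot
    obtain ⟨k, f, hk, hmono, hrad, -, hx⟩ := h.exists_chain hc.isCompactElement hc.ne_bot hcx hn
    exact ⟨k, f, hk, hmono, hrad, hx⟩

end InvertibleRadicals

end MultLattice

theorem theorem4p6 {L : Type*} [CommMonoid L] [CompleteLattice L] [IsMultiplicativeLattice L]
    [Nontrivial L]
    (hdomain : MultLattice.IsLatticeDomain L)
    (hC : MultLattice.IsCLattice L)
    (hprincipal : MultLattice.IsPrincipallyGenerated L) :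
    List.TFAE
      [ MultLattice.IsRadicalFactorial L,
        MultLattice.dim L ≤ 1 ∧
          ∀ x : L, MultLattice.IsLInvertible x → MultLattice.IsProductOfLRadicals x,
        ∀ p : L, MultLattice.IsLPrime p → p ≠ ⊥ →
          MultLattice.IsMaximalElement p ∧
            ∃ y : L, MultLattice.IsLInvertible y ∧ MultLattice.IsLRadical y ∧ y ≤ p,
        ∀ x : L, MultLattice.IsProductOfLRadicalChain x,
        ∀ x : L, IsCompactElement x → x ≠ ⊥ →
          MultLattice.IsLInvertible (MultLattice.radical x),
        (∀ x : L, IsCompactElement x → x ≠ ⊥ → MultLattice.IsLInvertible x) ∧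
          ∀ x : L, IsCompactElement x → IsCompactElement (MultLattice.radical x) ] := by
  have : MultLattice.IsPrincipalCLatticeDomain L := ⟨hdomain, hC, hprincipal⟩
  tfae_have 1 → 2 := fun h => ⟨h.dim_le_one, fun x _ => h x⟩
  tfae_have 2 → 3 := fun h p hp h0 => ⟨MultLattice.isMaximalElement_of_dim_le_one h.1 hp h0,
    MultLattice.exists_isLInvertible_isLRadical_le hp h0 h.2⟩
  tfae_have 3 → 5 := fun h x hx h0 =>
    MultLattice.HasRadicalUniformizers.isLInvertible_radical h hx h0
  tfae_have 5 → 6 := fun h =>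
    ⟨fun x hx h0 => MultLattice.HasInvertibleRadicals.isLInvertible h hx h0,
      fun x hx => MultLattice.HasInvertibleRadicals.isCompactElement_radical h hx⟩
  tfae_have 6 → 5 := fun h x hx h0 =>
    h.1 _ (h.2 x hx) (ne_bot_of_le_ne_bot h0 (MultLattice.le_radical x))
  tfae_have 5 → 4 := fun h x => MultLattice.HasInvertibleRadicals.isProductOfLRadicalChain h x
  tfae_have 4 → 1 := fun h x =>
    let ⟨n, f, hn, _, hf, hx⟩ := h x
    ⟨n, f, hn, hf, hx⟩
  tfae_finish
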